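/- Let $d\ge 0$ and let $\Omega\subset\mathbb{R}^d$ be a bounded, Lebesgue measurable set. Call $\Omega$ *spectral* if it has positive Lebesgue measure and there is a countable set $\Lambda\subset\mathbb{R}^d$ such that the system of exponential functions $\{e_\lambda\}_{\lambda\in\Lambda}$, $e_\lambda(x)=e^{2\pi i\langle\lambda,x\rangle}$, is orthogonal and complete in $L^2(\Omega)$, that is, these functions are pairwise orthogonal for distinct $\lambda\in\Lambda$ and their linear span is dense in $L^2(\Omega)$. **Theorem.** If $\Omega$ is spectral, then its complement $\Omega^\complement=\mathbb{R}^d\setminus\Omega$ admits a weak tiling by translates of $\Omega$. That is, there exists a positive, locally finite Borel measure $\mu$ on $\mathbb{R}^d$ such that $\mathbb{1}_\Omega*\mu=\mathbb{1}_{\Omega^\complement}$ almost everywhere with respect to Lebesgue measure, where $(\mathbb{1}_\Omega*\mu)(x)=\int_{\mathbb{R}^d}\mathbb{1}_\Omega(x-t)\,d\mu(t)$. -/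

import Mathlib

open MeasureTheory

noncomputable section

namespace WeakTiling

/-- The exponential function `e_l(x) = exp(2 π i ⟨l, x⟩)` on `ℝ^d`. -/
def expFun {d : ℕ} (l x : EuclideanSpace ℝ (Fin d)) : ℂ :=
  Complex.exp (2 * Real.pi * Complex.I * (inner ℝ l x : ℝ))

/-- On a bounded set every exponential function is square integrable. -/
theorem memLp_expFun {d : ℕ} {Ω : Set (EuclideanSpace ℝ (Fin d))}
    (hΩ : Bornology.IsBounded Ω) (l : EuclideanSpace ℝ (Fin d)) :
    MemLp (expFun l) 2 (volume.restrict Ω) := by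
  have : IsFiniteMeasure (volume.restrict Ω) :=
    isFiniteMeasure_restrict.mpr hΩ.measure_lt_top.ne
  refine MemLp.of_bound (C := 1) ?_ (Filter.Eventually.of_forall fun x => ?_)
  · refine Continuous.aestronglyMeasurable ?_
    unfold expFun
    fun_prop
  · simp [expFun, Complex.norm_exp]

/-- The exponential function `e_l`, as an element of the complex Hilbert space `L²(Ω)`. -/
def expL2 {d : ℕ} {Ω : Set (EuclideanSpace ℝ (Fin d))}
    (hΩ : Bornology.IsBounded Ω) (l : EuclideanSpace ℝ (Fin d)) :
    Lp ℂ 2 (volume.restrict Ω) :=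
  (memLp_expFun hΩ l).toLp (expFun l)

/-- `Λ` is a spectrum for the bounded set `Ω`: it is countable, and the system
`{e_l : l ∈ Λ}` is orthogonal and complete in `L²(Ω)`. -/
structure IsSpectrum {d : ℕ} {Ω : Set (EuclideanSpace ℝ (Fin d))}
    (hΩ : Bornology.IsBounded Ω) (Λ : Set (EuclideanSpace ℝ (Fin d))) : Prop where
  countable : Λ.Countable
  orthogonal : Λ.Pairwise fun l l' => inner ℂ (expL2 hΩ l) (expL2 hΩ l') = 0
  complete : (Submodule.span ℂ (expL2 hΩ '' Λ)).topologicalClosure = ⊤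

/-- The bounded set `Ω` is spectral: it has positive Lebesgue measure and admits a spectrum. -/
def IsSpectral {d : ℕ} {Ω : Set (EuclideanSpace ℝ (Fin d))}
    (hΩ : Bornology.IsBounded Ω) : Prop :=
  0 < volume Ω ∧ ∃ Λ : Set (EuclideanSpace ℝ (Fin d)), IsSpectrum hΩ Λ

/-- The convolution `(1_Ω * μ)(x) = ∫ 1_Ω(x - t) dμ(t)`, with values in `[0, ∞]`. -/
def indicatorConv {d : ℕ} (Ω : Set (EuclideanSpace ℝ (Fin d)))
    (μ : Measure (EuclideanSpace ℝ (Fin d))) (x : EuclideanSpace ℝ (Fin d)) : ENNReal :=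
  ∫⁻ t, Ω.indicator 1 (x - t) ∂μ

/-- `S` admits a weak tiling by translates of `Ω`: there is a positive, locally finite Borel
measure `μ` such that `1_Ω * μ = 1_S` almost everywhere with respect to Lebesgue measure. -/
def AdmitsWeakTiling {d : ℕ} (Ω S : Set (EuclideanSpace ℝ (Fin d))) : Prop :=
  ∃ μ : Measure (EuclideanSpace ℝ (Fin d)), IsLocallyFiniteMeasure μ ∧
    indicatorConv Ω μ =ᵐ[volume] S.indicator 1

end WeakTiling

end

open Filter Set Topology
open scoped Pointwise ENNReal NNReal CompactlySupported

/-- Vague compactness: a sequence of measures which is uniformly bounded on compact sets converges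
vaguely along any ultrafilter. -/
theorem exists_measure_tendsto_lintegral {X : Type*} [TopologicalSpace X] [T2Space X]
    [LocallyCompactSpace X] [MeasurableSpace X] [BorelSpace X] {ι : Type*} (𝒰 : Ultrafilter ι)
    (γ : ι → Measure X) (hγ : ∀ K : Set X, IsCompact K → ∃ C : ℝ≥0, ∀ i, γ i K ≤ C) :
    ∃ μ : Measure X, μ.Regular ∧
      ∀ φ : C_c(X, ℝ≥0), Tendsto (fun i => ∫⁻ x, φ x ∂γ i) 𝒰 (𝓝 (∫⁻ x, φ x ∂μ)) := by
  have hb : ∀ φ : C_c(X, ℝ≥0), ∃ C : ℝ≥0, ∀ i, ∫⁻ x, φ x ∂γ i ≤ C := by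
    intro φ
    obtain ⟨C, hC⟩ := hγ _ φ.hasCompactSupport
    obtain ⟨B, hB⟩ := (φ.hasCompactSupport.isCompact_range φ.continuous).bddAbove
    refine ⟨B * C, fun i => ?_⟩
    calc ∫⁻ x, φ x ∂γ i ≤ ∫⁻ x, (tsupport φ).indicator (fun _ => (B : ℝ≥0∞)) x ∂γ i := by
          refine lintegral_mono fun x => ?_
          by_cases hx : x ∈ tsupport φ
          · simpa [hx] using hB (mem_range_self x)
          · simp [image_eq_zero_of_notMem_tsupport hx]
      _ = B * γ i (tsupport φ) := by
          rw [lintegral_indicator (isClosed_tsupport _).measurableSet]; simp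
      _ ≤ _ := by rw [ENNReal.coe_mul]; gcongr; exact hC _
  have hlim : ∀ φ : C_c(X, ℝ≥0), ∃ c : ℝ≥0,
      Tendsto (fun i => ∫⁻ x, φ x ∂γ i) 𝒰 (𝓝 (c : ℝ≥0∞)) := by
    intro φ
    obtain ⟨C, hC⟩ := hb φ
    obtain ⟨a, ha, hlim⟩ := (isCompact_Icc (a := (0 : ℝ≥0∞)) (b := C)).ultrafilter_le_nhds
      (𝒰.map fun i => ∫⁻ x, φ x ∂γ i) (by
        rw [le_principal_iff]
        exact Filter.mem_map.2 (Filter.univ_mem' fun i => ⟨zero_le, hC i⟩))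
    lift a to ℝ≥0 using (ha.2.trans_lt ENNReal.coe_lt_top).ne
    exact ⟨a, hlim⟩
  choose L hL using hlim
  let Λ : C_c(X, ℝ≥0) →ₗ[ℝ≥0] ℝ≥0 :=
    { toFun := L
      map_add' := fun φ ψ => by
        have h := (hL φ).add (hL ψ)
        refine ENNReal.coe_injective (tendsto_nhds_unique (hL (φ + ψ)) ?_)
        rw [ENNReal.coe_add]
        refine h.congr fun i => ?_
        rw [← lintegral_add_left (by have := φ.continuous; fun_prop)]
        simp
      map_smul' := fun c φ => by
        have h := ENNReal.Tendsto.const_mul (a := (c : ℝ≥0∞)) (hL φ) (Or.inr ENNReal.coe_ne_top)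
        refine ENNReal.coe_injective (tendsto_nhds_unique (hL (c • φ)) ?_)
        simp only [RingHom.id_apply, smul_eq_mul, ENNReal.coe_mul]
        refine h.congr fun i => ?_
        rw [← lintegral_const_mul _ (by have := φ.continuous; fun_prop)]
        simp }
  refine ⟨NNRealRMK.rieszMeasure Λ, inferInstance, fun φ => ?_⟩
  rw [NNRealRMK.lintegral_rieszMeasure]
  exact hL φ

/-- A vague limit charges a point at least as much as the measures eventually charge its
neighbourhoods. -/
theorem one_le_measure_singleton_of_tendsto {X : Type*} [MetricSpace X] [ProperSpace X]
    [MeasurableSpace X] [BorelSpace X] {ι : Type*} {l : Filter ι} [l.NeBot]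
    {γ : ι → Measure X} {μ : Measure X} [IsFiniteMeasureOnCompacts μ]
    (hlim : ∀ φ : C_c(X, ℝ≥0), Tendsto (fun i => ∫⁻ x, φ x ∂γ i) l (𝓝 (∫⁻ x, φ x ∂μ))) (a : X)
    (hγ : ∀ ε : ℝ, 0 < ε → ∀ᶠ i in l, 1 - ENNReal.ofReal ε ≤ γ i (Metric.ball a ε)) :
    1 ≤ μ {a} := by
  have key : ∀ δ : ℝ, 0 < δ → 1 ≤ μ (Metric.closedBall a δ) := by
    intro δ hδ
    obtain ⟨f, hf1, hf0, hfc, hf01⟩ := exists_continuous_one_zero_of_isCompact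
      (isCompact_closedBall a (δ / 2)) (Metric.isOpen_ball (x := a) (ε := δ)).isClosed_compl (by
        rw [disjoint_compl_right_iff_subset]
        exact Metric.closedBall_subset_ball (by linarith))
    let φ : C_c(X, ℝ≥0) := ⟨⟨fun x => (f x).toNNReal, by fun_prop⟩,
        hfc.comp_left (g := Real.toNNReal) Real.toNNReal_zero⟩
    have h1 : ∫⁻ x, φ x ∂μ ≤ μ (Metric.closedBall a δ) := by
      rw [← lintegral_indicator_one Metric.isClosed_closedBall.measurableSet]
      refine lintegral_mono fun x => ?_
      by_cases hx : x ∈ Metric.closedBall a δ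
      · rw [indicator_of_mem hx]
        have := (hf01 x).2
        simpa [φ] using this
      · have : f x = 0 := hf0 fun h => hx (Metric.ball_subset_closedBall h)
        simp [φ, this]
    refine le_trans ?_ h1
    refine ENNReal.le_of_forall_pos_le_add fun ε hε _ => ?_
    rw [← tsub_le_iff_right]
    refine ge_of_tendsto (hlim φ) ?_
    have hpos : 0 < min (ε : ℝ) (δ / 2) := lt_min (by exact_mod_cast hε) (by linarith)
    filter_upwards [hγ _ hpos] with i hi
    calc (1 : ℝ≥0∞) - ε ≤ 1 - ENNReal.ofReal (min (ε : ℝ) (δ / 2)) := by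
          refine tsub_le_tsub_left ?_ _
          exact (ENNReal.ofReal_le_ofReal (min_le_left _ _)).trans (by simp)
      _ ≤ _ := hi
      _ = ∫⁻ x, (Metric.ball a (min (ε : ℝ) (δ / 2))).indicator 1 x ∂γ i :=
          (lintegral_indicator_one Metric.isOpen_ball.measurableSet).symm
      _ ≤ _ := by
          refine lintegral_mono fun x => ?_
          by_cases hx : x ∈ Metric.ball a (min (ε : ℝ) (δ / 2))
          · have : f x = 1 := hf1 (Metric.ball_subset_closedBall
              (Metric.ball_subset_ball (min_le_right _ _) hx))
            simp [φ, this, hx]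
          · simp [hx]
  have hI : (⋂ n : ℕ, Metric.closedBall a (1 / ((n : ℝ) + 1))) = {a} := by
    refine Subset.antisymm (fun x hx => ?_) (by
      rintro _ rfl
      exact mem_iInter.2 fun n => Metric.mem_closedBall_self (by positivity))
    rw [mem_iInter] at hx
    have : dist x a ≤ 0 := ge_of_tendsto' tendsto_one_div_add_atTop_nhds_zero_nat hx
    exact dist_le_zero.1 this
  rw [← hI, Antitone.measure_iInter]
  · exact le_iInf fun n => key _ (by positivity)
  · intro m n h
    refine Metric.closedBall_subset_closedBall ?_
    have : (m : ℝ) ≤ n := by exact_mod_cast h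
    gcongr
  · exact fun n => Metric.isClosed_closedBall.measurableSet.nullMeasurableSet
  · exact ⟨0, (isCompact_closedBall _ _).measure_lt_top.ne⟩

namespace WeakTiling

variable {d : ℕ} {Ω : Set (EuclideanSpace ℝ (Fin d))}

theorem measurable_indicatorConv (hm : MeasurableSet Ω) (μ : Measure (EuclideanSpace ℝ (Fin d)))
    [SFinite μ] : Measurable (indicatorConv Ω μ) := by
  have h : Measurable (Function.uncurry fun x t : EuclideanSpace ℝ (Fin d) =>
      Ω.indicator (1 : EuclideanSpace ℝ (Fin d) → ℝ≥0∞) (x - t)) :=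
    (measurable_one.indicator hm).comp measurable_sub
  exact h.lintegral_prod_right'

/-- Tonelli's theorem for the convolution with an indicator function. -/
theorem lintegral_mul_indicatorConv (hm : MeasurableSet Ω)
    (μ : Measure (EuclideanSpace ℝ (Fin d))) [SFinite μ]
    {φ : EuclideanSpace ℝ (Fin d) → ℝ≥0∞} (hφ : Measurable φ) :
    ∫⁻ x, φ x * indicatorConv Ω μ x = ∫⁻ t, (∫⁻ u in Ω, φ (u + t)) ∂μ := by
  have h : Measurable (fun p : EuclideanSpace ℝ (Fin d) × EuclideanSpace ℝ (Fin d) =>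
      Ω.indicator (1 : EuclideanSpace ℝ (Fin d) → ℝ≥0∞) (p.1 - p.2)) :=
    (measurable_one.indicator hm).comp measurable_sub
  simp only [indicatorConv]
  calc _ = ∫⁻ x, ∫⁻ t, φ x * Ω.indicator 1 (x - t) ∂μ := by
        refine lintegral_congr fun x => (lintegral_const_mul _ ?_).symm
        exact h.comp measurable_prodMk_left
    _ = ∫⁻ t, (∫⁻ x, φ x * Ω.indicator 1 (x - t)) ∂μ :=
        lintegral_lintegral_swap ((hφ.comp measurable_fst).mul h).aemeasurable
    _ = _ := by
        refine lintegral_congr fun t => ?_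
        rw [← lintegral_add_right_eq_self _ t, ← lintegral_indicator hm]
        refine lintegral_congr fun u => ?_
        by_cases hu : u ∈ Ω <;> simp [hu]

/-- The convolution with the indicator function does not change, almost everywhere, when the set
is modified on a null set. -/
theorem indicatorConv_congr_ae {Ω' : Set (EuclideanSpace ℝ (Fin d))} (h : Ω =ᵐ[volume] Ω')
    (μ : Measure (EuclideanSpace ℝ (Fin d))) [SFinite μ] :
    indicatorConv Ω μ =ᵐ[volume] indicatorConv Ω' μ := by
  obtain ⟨N, hN, hNm, hN0⟩ := exists_measurable_superset_of_null (ae_iff.1 h)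
  have h0 : indicatorConv N μ =ᵐ[volume] 0 := by
    rw [← lintegral_eq_zero_iff (measurable_indicatorConv hNm μ)]
    have := lintegral_mul_indicatorConv hNm μ (φ := 1) measurable_one
    simpa [hN0] using this
  filter_upwards [h0] with x hx
  have hm : Measurable fun t => N.indicator (1 : EuclideanSpace ℝ (Fin d) → ℝ≥0∞) (x - t) :=
    (measurable_one.indicator hNm).comp (measurable_const.sub measurable_id)
  have := (lintegral_eq_zero_iff hm).1 hx
  refine lintegral_congr_ae ?_
  filter_upwards [this] with t ht
  have hxt : x - t ∉ N := fun hmem => by simp [hmem] at ht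
  have : ¬ ¬ (x - t ∈ Ω) = (x - t ∈ Ω') := fun hne => hxt (hN hne)
  rw [not_not] at this
  by_cases hx' : x - t ∈ Ω
  · simp [hx', this ▸ hx']
  · simp [hx', this ▸ hx']

/-- If translates of `Ω` tile `ℝ^d` weakly with `μ`, then `μ` is bounded on bounded sets by a
constant depending only on `Ω`. -/
theorem exists_measure_le_of_indicatorConv_eq_one (hb : Bornology.IsBounded Ω)
    (hm : MeasurableSet Ω) (hpos : 0 < volume Ω) {K : Set (EuclideanSpace ℝ (Fin d))}
    (hK : IsCompact K) :
    ∃ C : ℝ≥0, ∀ μ : Measure (EuclideanSpace ℝ (Fin d)), SFinite μ →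
      (∀ x, indicatorConv Ω μ x = 1) → μ K ≤ C := by
  obtain ⟨R, hR⟩ := (hb.add hK.isBounded).subset_ball 0
  have hfin : volume (Metric.ball (0 : EuclideanSpace ℝ (Fin d)) R) / volume Ω ≠ ∞ :=
    ENNReal.div_ne_top measure_ball_lt_top.ne hpos.ne'
  refine ⟨(volume (Metric.ball (0 : EuclideanSpace ℝ (Fin d)) R) / volume Ω).toNNReal,
    fun μ _ hμ => ?_⟩
  rw [ENNReal.coe_toNNReal hfin, ENNReal.le_div_iff_mul_le (Or.inl hpos.ne')
    (Or.inl hb.measure_lt_top.ne)]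
  have hB : MeasurableSet (Metric.ball (0 : EuclideanSpace ℝ (Fin d)) R) :=
    Metric.isOpen_ball.measurableSet
  have h := lintegral_mul_indicatorConv hm μ (measurable_one.indicator hB)
  simp only [hμ, mul_one, lintegral_indicator_one hB] at h
  rw [h, mul_comm, ← lintegral_indicator_const hK.measurableSet]
  refine lintegral_mono fun t => ?_
  by_cases ht : t ∈ K
  · rw [indicator_of_mem ht, ← setLIntegral_one]
    refine setLIntegral_mono' hm fun u hu => ?_
    rw [indicator_of_mem (hR (add_mem_add hu ht))]
    rfl
  · simp [ht]

/-- The property `1_Ω * μ = 1` passes to vague limits. -/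
theorem indicatorConv_ae_eq_one_of_tendsto (hb : Bornology.IsBounded Ω) (hm : MeasurableSet Ω)
    {ι : Type*} {l : Filter ι} [l.NeBot] {γ : ι → Measure (EuclideanSpace ℝ (Fin d))}
    [∀ i, SFinite (γ i)] {μ : Measure (EuclideanSpace ℝ (Fin d))} [SFinite μ]
    (hlim : ∀ φ : C_c(EuclideanSpace ℝ (Fin d), ℝ≥0),
      Tendsto (fun i => ∫⁻ x, φ x ∂γ i) l (𝓝 (∫⁻ x, φ x ∂μ)))
    (hγ : ∀ i x, indicatorConv Ω (γ i) x = 1) :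
    indicatorConv Ω μ =ᵐ[volume] 1 := by
  have hcm := measurable_indicatorConv hm μ
  have key : ∀ φ : C_c(EuclideanSpace ℝ (Fin d), ℝ≥0),
      ∫⁻ x, φ x * indicatorConv Ω μ x = ∫⁻ x, φ x := by
    intro φ
    have hφm : Measurable fun x => (φ x : ℝ≥0∞) := by
      have := φ.continuous
      fun_prop
    obtain ⟨B, hB⟩ := (φ.hasCompactSupport.isCompact_range φ.continuous).bddAbove
    have hψc : Continuous fun t => ∫ u in Ω, (φ (u + t) : ℝ) := by
      refine continuous_of_dominated (bound := fun _ => (B : ℝ)) (fun t => ?_) (fun t => ?_) ?_ ?_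
      · have := φ.continuous
        exact Continuous.aestronglyMeasurable (by fun_prop)
      · refine Eventually.of_forall fun u => ?_
        simpa using hB (mem_range_self (u + t))
      · exact integrableOn_const hb.measure_lt_top.ne
      · refine Eventually.of_forall fun u => ?_
        have := φ.continuous
        fun_prop
    have hψs : HasCompactSupport fun t => ∫ u in Ω, (φ (u + t) : ℝ) := by
      have hK := φ.hasCompactSupport.isCompact.isBounded.sub hb
      refine HasCompactSupport.of_support_subset_isCompact
        (K := closure (tsupport φ - Ω)) hK.isCompact_closure ?_
      intro t ht
      by_contra hnot
      refine ht (setIntegral_eq_zero_of_forall_eq_zero fun u hu => ?_)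
      have : u + t ∉ tsupport φ := fun h => hnot (subset_closure ⟨u + t, h, u, hu, by simp⟩)
      simp [image_eq_zero_of_notMem_tsupport this]
    let ψ : C_c(EuclideanSpace ℝ (Fin d), ℝ≥0) :=
      ⟨⟨fun t => (∫ u in Ω, (φ (u + t) : ℝ)).toNNReal, by fun_prop⟩,
        hψs.comp_left (g := Real.toNNReal) Real.toNNReal_zero⟩
    have hψ : ∀ t, (ψ t : ℝ≥0∞) = ∫⁻ u in Ω, φ (u + t) := by
      intro t
      change ENNReal.ofReal (∫ u in Ω, (φ (u + t) : ℝ)) = _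
      rw [ofReal_integral_eq_lintegral_ofReal]
      · simp
      · have hc := φ.continuous
        refine Measure.integrableOn_of_bounded hb.measure_lt_top.ne
          (Continuous.aestronglyMeasurable (by fun_prop)) (M := B) (Eventually.of_forall fun u => ?_)
        simpa using hB (mem_range_self (u + t))
      · exact Eventually.of_forall fun u => NNReal.coe_nonneg _
    have h1 := hlim ψ
    simp only [hψ, ← lintegral_mul_indicatorConv hm _ hφm, hγ, mul_one] at h1
    exact tendsto_nhds_unique h1 tendsto_const_nhds
  have hlf : IsFiniteMeasureOnCompacts (volume.withDensity (indicatorConv Ω μ)) := by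
    refine ⟨fun K hK => ?_⟩
    obtain ⟨f, hf1, -, hfc, hf01⟩ := exists_continuous_one_zero_of_isCompact hK
      isClosed_empty (disjoint_empty K)
    let φ : C_c(EuclideanSpace ℝ (Fin d), ℝ≥0) :=
      ⟨⟨fun x => (f x).toNNReal, by fun_prop⟩,
        hfc.comp_left (g := Real.toNNReal) Real.toNNReal_zero⟩
    rw [withDensity_apply _ hK.measurableSet]
    calc ∫⁻ x in K, indicatorConv Ω μ x ≤ ∫⁻ x, φ x * indicatorConv Ω μ x := by
          rw [← lintegral_indicator hK.measurableSet]
          refine lintegral_mono fun x => ?_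
          by_cases hx : x ∈ K
          · simp [hx, φ, hf1 hx]
          · simp [hx]
      _ = ∫⁻ x, φ x := key φ
      _ < ∞ := (f.continuous.integrable_of_hasCompactSupport hfc).lintegral_lt_top
  have heq : volume.withDensity (indicatorConv Ω μ) = volume := by
    refine Measure.ext_of_integral_eq_on_compactlySupported_nnreal fun φ => ?_
    have hφm : Measurable fun x => (φ x : ℝ≥0∞) := by
      have := φ.continuous
      fun_prop
    have hφs : Continuous fun x => (φ x : ℝ) := by
      have := φ.continuous
      fun_prop
    rw [integral_eq_lintegral_of_nonneg_ae (Eventually.of_forall fun x => NNReal.coe_nonneg _)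
      hφs.aestronglyMeasurable, integral_eq_lintegral_of_nonneg_ae
      (Eventually.of_forall fun x => NNReal.coe_nonneg _) hφs.aestronglyMeasurable]
    simp only [ENNReal.ofReal_coe_nnreal]
    rw [lintegral_withDensity_eq_lintegral_mul _ hcm hφm, ← key φ]
    simp [mul_comm]
  rw [← withDensity_eq_iff_of_sigmaFinite hcm.aemeasurable measurable_one.aemeasurable, heq,
    withDensity_one]

end WeakTiling

theorem enorm_sq_eq_lintegral {α F : Type*} [MeasurableSpace α] {μ : Measure α}
    [NormedAddCommGroup F] (f : Lp F 2 μ) : ‖f‖ₑ ^ 2 = ∫⁻ x, ‖f x‖ₑ ^ 2 ∂μ := by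
  have h := eLpNorm_nnreal_pow_eq_lintegral (μ := μ) (f := f) (p := 2) two_ne_zero
  rw [Lp.enorm_def]
  simpa using h

theorem norm_sum_smul_sq_of_pairwise_inner_eq_zero {ι H : Type*} [NormedAddCommGroup H]
    [InnerProductSpace ℂ H] {v : ι → H} {s : Set ι}
    (hv : s.Pairwise fun i j => inner ℂ (v i) (v j) = 0) {F : Finset ι} (hF : ↑F ⊆ s)
    (c : ι → ℂ) : ‖∑ i ∈ F, c i • v i‖ ^ 2 = ∑ i ∈ F, ‖c i‖ ^ 2 * ‖v i‖ ^ 2 := by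
  classical
  induction F using Finset.induction_on with
  | empty => simp
  | insert a F ha ih =>
    rw [Finset.coe_insert, insert_subset_iff] at hF
    have h0 : inner ℂ (c a • v a) (∑ i ∈ F, c i • v i) = 0 := by
      rw [inner_sum]
      refine Finset.sum_eq_zero fun i hi => ?_
      rw [inner_smul_left, inner_smul_right,
        hv hF.1 (hF.2 hi) (fun h => ha (h ▸ hi)), mul_zero, mul_zero]
    have := norm_add_sq_eq_norm_sq_add_norm_sq_of_inner_eq_zero _ _ h0
    rw [Finset.sum_insert ha, Finset.sum_insert ha, ← ih hF.2, sq, this, norm_smul]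
    ring

namespace WeakTiling

variable {d : ℕ} {Ω : Set (EuclideanSpace ℝ (Fin d))}

theorem continuous_expFun (l : EuclideanSpace ℝ (Fin d)) : Continuous (expFun l) := by
  unfold expFun
  fun_prop

theorem norm_expFun (l x : EuclideanSpace ℝ (Fin d)) : ‖expFun l x‖ = 1 := by
  simp [expFun, Complex.norm_exp]

theorem expFun_sub (l x y : EuclideanSpace ℝ (Fin d)) :
    expFun l (x - y) = expFun l x * (starRingEnd ℂ) (expFun l y) := by
  simp only [expFun, ← Complex.exp_conj, ← Complex.exp_add, inner_sub_right]
  congr 1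
  simp only [map_mul, Complex.conj_I, Complex.conj_ofReal, Complex.conj_ofNat]
  push_cast
  ring

theorem coeFn_sum_smul_expL2 (hΩ : Bornology.IsBounded Ω) (F : Finset (EuclideanSpace ℝ (Fin d)))
    (c : EuclideanSpace ℝ (Fin d) → ℂ) :
    (∑ l ∈ F, c l • expL2 hΩ l : Lp ℂ 2 (volume.restrict Ω)) =ᵐ[volume.restrict Ω]
      fun x => ∑ l ∈ F, c l * expFun l x := by
  classical
  induction F using Finset.induction_on with
  | empty =>
    simp only [Finset.sum_empty]
    exact Lp.coeFn_zero _ _ _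
  | insert a F ha ih =>
    simp only [Finset.sum_insert ha]
    filter_upwards [ih, Lp.coeFn_add (c a • expL2 hΩ a) (∑ l ∈ F, c l • expL2 hΩ l),
      Lp.coeFn_smul (c a) (expL2 hΩ a), (memLp_expFun hΩ a).coeFn_toLp] with x h1 h2 h3 h4
    rw [h2, Pi.add_apply, h1, h3, Pi.smul_apply, expL2, h4, smul_eq_mul]

/-- Parseval's identity for trigonometric polynomials with frequencies in a spectrum. -/
theorem lintegral_enorm_sq_trigPoly {hΩ : Bornology.IsBounded Ω}
    {Λ : Set (EuclideanSpace ℝ (Fin d))} (hΛ : IsSpectrum hΩ Λ)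
    {F : Finset (EuclideanSpace ℝ (Fin d))} (hF : ↑F ⊆ Λ) (c : EuclideanSpace ℝ (Fin d) → ℂ) :
    ∫⁻ x in Ω, ‖∑ l ∈ F, c l * expFun l x‖ₑ ^ 2 =
      ENNReal.ofReal (∑ l ∈ F, ‖c l‖ ^ 2 * ‖expL2 hΩ l‖ ^ 2) := by
  rw [← norm_sum_smul_sq_of_pairwise_inner_eq_zero hΛ.orthogonal hF,
    ENNReal.ofReal_pow (norm_nonneg _), ofReal_norm, enorm_sq_eq_lintegral]
  refine lintegral_congr_ae ?_
  filter_upwards [coeFn_sum_smul_expL2 hΩ F c] with x hx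
  rw [hx]

/-- A trigonometric polynomial with frequencies in a spectrum has the same `L²` norm on all
translates of `-Ω`. -/
theorem lintegral_enorm_sq_trigPoly_sub {hΩ : Bornology.IsBounded Ω}
    {Λ : Set (EuclideanSpace ℝ (Fin d))} (hΛ : IsSpectrum hΩ Λ)
    {F : Finset (EuclideanSpace ℝ (Fin d))} (hF : ↑F ⊆ Λ) (c : EuclideanSpace ℝ (Fin d) → ℂ)
    (z : EuclideanSpace ℝ (Fin d)) :
    ∫⁻ x in Ω, ‖∑ l ∈ F, c l * expFun l (z - x)‖ₑ ^ 2 =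
      ∫⁻ x in Ω, ‖∑ l ∈ F, c l * expFun l x‖ₑ ^ 2 := by
  have h : ∀ x, ‖∑ l ∈ F, c l * expFun l (z - x)‖ₑ =
      ‖∑ l ∈ F, (starRingEnd ℂ) (c l * expFun l z) * expFun l x‖ₑ := by
    intro x
    rw [← RCLike.enorm_conj, map_sum]
    congr 1
    refine Finset.sum_congr rfl fun l _ => ?_
    simp [expFun_sub, mul_assoc]
  simp only [h, lintegral_enorm_sq_trigPoly hΛ hF]
  simp [norm_expFun]

/-- Trigonometric polynomials with frequencies in a spectrum can have their `L²` norm on `Ω`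
concentrated on any given part of `Ω` of positive measure. -/
theorem exists_trigPoly_concentrated {hΩ : Bornology.IsBounded Ω}
    {Λ : Set (EuclideanSpace ℝ (Fin d))} (hΛ : IsSpectrum hΩ Λ)
    {B : Set (EuclideanSpace ℝ (Fin d))} (hB : MeasurableSet B) (hpos : volume.restrict Ω B ≠ 0)
    {ε : ℝ} (hε : 0 < ε) :
    ∃ (F : Finset (EuclideanSpace ℝ (Fin d))) (c : EuclideanSpace ℝ (Fin d) → ℂ), ↑F ⊆ Λ ∧
      ∫⁻ x in Ω, ‖∑ l ∈ F, c l * expFun l x‖ₑ ^ 2 ≠ 0 ∧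
      ∫⁻ x in Bᶜ, ‖∑ l ∈ F, c l * expFun l x‖ₑ ^ 2 ∂(volume.restrict Ω) ≤
        ENNReal.ofReal ε * ∫⁻ x in Ω, ‖∑ l ∈ F, c l * expFun l x‖ₑ ^ 2 := by
  have : IsFiniteMeasure (volume.restrict Ω) :=
    isFiniteMeasure_restrict.mpr hΩ.measure_lt_top.ne
  let k : Lp ℂ 2 (volume.restrict Ω) := indicatorConstLp 2 hB (measure_ne_top _ _) 1
  have hk : 0 < ‖k‖ := by
    rw [norm_indicatorConstLp two_ne_zero ENNReal.ofNat_ne_top]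
    have : 0 < (volume.restrict Ω).real B := ENNReal.toReal_pos hpos (measure_ne_top _ _)
    simp only [norm_one, one_mul]
    positivity
  set δ := min ε 1 with hδ
  have hδ0 : 0 < δ := lt_min hε one_pos
  have hδ1 : δ ≤ 1 := min_le_right _ _
  have hmem : k ∈ closure
      (Submodule.span ℂ (expL2 hΩ '' Λ) : Set (Lp ℂ 2 (volume.restrict Ω))) := by
    rw [← Submodule.topologicalClosure_coe, hΛ.complete]
    trivial
  obtain ⟨h, hh, hdist⟩ := Metric.mem_closure_iff.1 hmem (δ * ‖k‖ / 2) (by positivity)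
  obtain ⟨c, hc, rfl⟩ := (Finsupp.mem_span_image_iff_linearCombination ℂ).1 hh
  rw [Finsupp.linearCombination_apply, Finsupp.sum] at hdist
  set h := ∑ l ∈ c.support, c l • expL2 hΩ l with h_def
  have hcoe := coeFn_sum_smul_expL2 hΩ c.support c
  rw [dist_comm, dist_eq_norm] at hdist
  have hnorm : ∫⁻ x in Ω, ‖∑ l ∈ c.support, c l * expFun l x‖ₑ ^ 2 = ‖h‖ₑ ^ 2 := by
    rw [enorm_sq_eq_lintegral]
    refine lintegral_congr_ae ?_
    filter_upwards [hcoe] with x hx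
    rw [hx]
  have hlow : ‖k‖ / 2 ≤ ‖h‖ := by
    have h1 : ‖k‖ ≤ ‖h‖ + ‖h - k‖ := by
      rw [norm_sub_rev]; simpa using norm_add_le h (k - h)
    nlinarith
  refine ⟨c.support, c, (Finsupp.mem_supported _ _).1 hc, ?_, ?_⟩
  · rw [hnorm]
    refine pow_ne_zero _ (enorm_ne_zero.2 (norm_pos_iff.1 (by linarith)))
  · rw [hnorm]
    calc _ = ∫⁻ x in Bᶜ, ‖(h - k : Lp ℂ 2 (volume.restrict Ω)) x‖ₑ ^ 2 ∂(volume.restrict Ω) := by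
          refine setLIntegral_congr_fun_ae hB.compl ?_
          filter_upwards [hcoe, Lp.coeFn_sub h k,
            indicatorConstLp_coeFn (p := 2) (hs := hB)
              (hμs := measure_ne_top (volume.restrict Ω) B) (c := (1 : ℂ))] with x h1 h2 h3 hx
          have h3' : k x = 0 := by rw [h3, indicator_of_notMem hx]
          rw [h2, Pi.sub_apply, h1, h3', sub_zero]
      _ ≤ ‖h - k‖ₑ ^ 2 := by
          rw [enorm_sq_eq_lintegral]
          exact setLIntegral_le_lintegral _ _
      _ = ENNReal.ofReal (‖h - k‖ ^ 2) := by
          rw [ENNReal.ofReal_pow (norm_nonneg _), ofReal_norm]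
      _ ≤ ENNReal.ofReal (ε * ‖h‖ ^ 2) := by
          refine ENNReal.ofReal_le_ofReal ?_
          calc ‖h - k‖ ^ 2 ≤ (δ * ‖k‖ / 2) ^ 2 := by gcongr
            _ = δ * (δ * (‖k‖ / 2) ^ 2) := by ring
            _ ≤ ε * (1 * ‖h‖ ^ 2) := by
              gcongr
              exact min_le_left _ _
            _ = _ := by ring
      _ = _ := by
          rw [ENNReal.ofReal_mul hε.le, ENNReal.ofReal_pow (norm_nonneg _), ofReal_norm]

/-- A spectral set weakly tiles the space by measures which charge small balls around the origin
with mass almost `1`. -/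
theorem exists_indicatorConv_eq_one {hΩ : Bornology.IsBounded Ω}
    {Λ : Set (EuclideanSpace ℝ (Fin d))} (hΛ : IsSpectrum hΩ Λ)
    {S : Set (EuclideanSpace ℝ (Fin d))} (hS : MeasurableSet S) (hSΩ : S =ᵐ[volume] Ω)
    (hpos : volume S ≠ 0) {ε : ℝ} (hε : 0 < ε) :
    ∃ γ : Measure (EuclideanSpace ℝ (Fin d)), SFinite γ ∧ (∀ x, indicatorConv S γ x = 1) ∧
      1 - ENNReal.ofReal ε ≤ γ (Metric.ball 0 ε) := by
  have hres : volume.restrict S = volume.restrict Ω := Measure.restrict_congr_set hSΩ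
  obtain ⟨t, -, ht⟩ := exists_mem_forall_mem_nhdsWithin_pos_measure
    (μ := volume.restrict Ω) (s := S) (by
      rw [← hres, Measure.restrict_apply_self]; exact hpos)
  have hB : MeasurableSet (Metric.ball t ε) := Metric.isOpen_ball.measurableSet
  obtain ⟨F, c, hF, hM0, hconc⟩ := exists_trigPoly_concentrated hΛ hB
    (ht _ (mem_nhdsWithin_of_mem_nhds (Metric.ball_mem_nhds t hε))).ne' hε
  have hMtop : ∫⁻ x in Ω, ‖∑ l ∈ F, c l * expFun l x‖ₑ ^ 2 ≠ ∞ := by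
    rw [lintegral_enorm_sq_trigPoly hΛ hF]
    exact ENNReal.ofReal_ne_top
  have hsub := lintegral_enorm_sq_trigPoly_sub hΛ hF c
  set g : EuclideanSpace ℝ (Fin d) → ℂ := fun x => ∑ l ∈ F, c l * expFun l x
  have hgc : Continuous g :=
    continuous_finsetSum _ fun l _ => continuous_const.mul (continuous_expFun l)
  change ∫⁻ x in Ω, ‖g x‖ₑ ^ 2 ≠ 0 at hM0
  change ∫⁻ x in Ω, ‖g x‖ₑ ^ 2 ≠ ∞ at hMtop
  change ∫⁻ x in (Metric.ball t ε)ᶜ, ‖g x‖ₑ ^ 2 ∂(volume.restrict Ω) ≤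
    ENNReal.ofReal ε * ∫⁻ x in Ω, ‖g x‖ₑ ^ 2 at hconc
  change ∀ z, ∫⁻ x in Ω, ‖g (z - x)‖ₑ ^ 2 = ∫⁻ x in Ω, ‖g x‖ₑ ^ 2 at hsub
  clear_value g
  set M := ∫⁻ x in Ω, ‖g x‖ₑ ^ 2
  have hfm : Measurable fun x => ‖g (x + t)‖ₑ ^ 2 / M := by
    have : Measurable fun x => g (x + t) := (hgc.comp (by fun_prop)).measurable
    exact (this.enorm.pow_const 2).div_const M
  refine ⟨volume.withDensity fun x => ‖g (x + t)‖ₑ ^ 2 / M, inferInstance, fun x => ?_, ?_⟩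
  · have hm : Measurable fun y => S.indicator (1 : EuclideanSpace ℝ (Fin d) → ℝ≥0∞) (x - y) :=
      (measurable_one.indicator hS).comp (measurable_const.sub measurable_id)
    rw [indicatorConv, lintegral_withDensity_eq_lintegral_mul _ hfm hm,
      ← lintegral_sub_left_eq_self _ x]
    calc _ = ∫⁻ u, S.indicator (fun u => ‖g (x + t - u)‖ₑ ^ 2 / M) u := by
          refine lintegral_congr fun u => ?_
          have : x - u + t = x + t - u := by abel
          by_cases hu : u ∈ S <;> simp [hu, this]
      _ = ∫⁻ u in Ω, ‖g (x + t - u)‖ₑ ^ 2 / M := by rw [lintegral_indicator hS, hres]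
      _ = 1 := by
          simp only [div_eq_mul_inv]
          rw [lintegral_mul_const' _ _ (ENNReal.inv_ne_top.2 hM0), hsub,
            ENNReal.mul_inv_cancel hM0 hMtop]
  · rw [tsub_le_iff_right, withDensity_apply _ Metric.isOpen_ball.measurableSet]
    have hball : ∫⁻ x in Metric.ball 0 ε, ‖g (x + t)‖ₑ ^ 2 / M =
        ∫⁻ x in Metric.ball t ε, ‖g x‖ₑ ^ 2 / M := by
      rw [← lintegral_indicator hB, ← lintegral_indicator Metric.isOpen_ball.measurableSet,
        ← lintegral_add_right_eq_self ((Metric.ball t ε).indicator _) t]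
      refine lintegral_congr fun x => ?_
      by_cases hx : x ∈ Metric.ball 0 ε
      · have : x + t ∈ Metric.ball t ε := by simpa using hx
        rw [indicator_of_mem hx, indicator_of_mem this]
      · have : x + t ∉ Metric.ball t ε := by simpa using hx
        rw [indicator_of_notMem hx, indicator_of_notMem this]
    rw [hball]
    simp only [div_eq_mul_inv]
    rw [lintegral_mul_const' _ _ (ENNReal.inv_ne_top.2 hM0)]
    calc (1 : ℝ≥0∞) = M * M⁻¹ := (ENNReal.mul_inv_cancel hM0 hMtop).symm
      _ ≤ ((∫⁻ x in Metric.ball t ε, ‖g x‖ₑ ^ 2) + ENNReal.ofReal ε * M) * M⁻¹ := by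
          gcongr
          refine (lintegral_add_compl _ hB).symm.le.trans (add_le_add ?_ hconc)
          exact lintegral_mono' (Measure.restrict_mono_measure Measure.restrict_le_self _) le_rfl
      _ = _ := by rw [add_mul, mul_assoc, ENNReal.mul_inv_cancel hM0 hMtop, mul_one]

/-- If `1_Ω * γ = 1` and `γ` has an atom of mass at least `1` at the origin, then removing a unit
mass there gives a weak tiling of the complement of `Ω`. -/
theorem admitsWeakTiling_compl_of_one_le {γ : Measure (EuclideanSpace ℝ (Fin d))}
    [IsLocallyFiniteMeasure γ] (hγ : indicatorConv Ω γ =ᵐ[volume] 1) (h0 : 1 ≤ γ {0}) :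
    AdmitsWeakTiling Ω Ωᶜ := by
  have hle : Measure.dirac 0 ≤ γ := by
    refine Measure.le_iff.2 fun s hs => ?_
    by_cases hs0 : (0 : EuclideanSpace ℝ (Fin d)) ∈ s
    · rw [Measure.dirac_apply_of_mem hs0]
      exact h0.trans (measure_mono (singleton_subset_iff.2 hs0))
    · rw [Measure.dirac_apply' _ hs, indicator_of_notMem hs0]
      exact zero_le
  refine ⟨γ - Measure.dirac 0, Measure.isLocallyFiniteMeasure_of_le Measure.sub_le, ?_⟩
  filter_upwards [hγ] with x hx
  have hadd : indicatorConv Ω (γ - Measure.dirac 0) x + Ω.indicator 1 x = 1 := by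
    rw [← Measure.sub_add_cancel_of_le hle, indicatorConv, lintegral_add_measure,
      lintegral_dirac, sub_zero] at hx
    exact hx
  by_cases hxΩ : x ∈ Ω
  · have : indicatorConv Ω (γ - Measure.dirac 0) x + 1 = 0 + 1 := by simpa [hxΩ] using hadd
    rw [indicator_of_notMem (notMem_compl_iff.2 hxΩ)]
    exact (ENNReal.add_left_inj ENNReal.one_ne_top).1 this
  · simpa [hxΩ] using hadd

end WeakTiling

theorem theorem1p4 {d : ℕ} {Ω : Set (EuclideanSpace ℝ (Fin d))}
    (hb : Bornology.IsBounded Ω) (hm : NullMeasurableSet Ω volume)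
    (hs : WeakTiling.IsSpectral hb) :
    WeakTiling.AdmitsWeakTiling Ω Ωᶜ := by
  obtain ⟨hpos, Λ, hΛ⟩ := hs
  obtain ⟨S, hSΩ, hS, hae⟩ := hm.exists_measurable_subset_ae_eq
  have hSpos : 0 < volume S := by rwa [measure_congr hae]
  have hSb : Bornology.IsBounded S := hb.subset hSΩ
  choose γ hγf hγ1 hγ0 using fun n : ℕ => WeakTiling.exists_indicatorConv_eq_one hΛ hS hae
    hSpos.ne' (Nat.one_div_pos_of_nat (α := ℝ) (n := n))
  obtain ⟨μ, hμr, hμ⟩ := exists_measure_tendsto_lintegral (hyperfilter ℕ) γ fun K hK => by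
    obtain ⟨C, hC⟩ := WeakTiling.exists_measure_le_of_indicatorConv_eq_one hSb hS hSpos hK
    exact ⟨C, fun n => hC _ (hγf n) (hγ1 n)⟩
  refine WeakTiling.admitsWeakTiling_compl_of_one_le (γ := μ) ?_ ?_
  · exact (WeakTiling.indicatorConv_congr_ae hae μ).symm.trans
      (WeakTiling.indicatorConv_ae_eq_one_of_tendsto hSb hS hμ hγ1)
  · refine one_le_measure_singleton_of_tendsto hμ 0 fun ε hε => ?_
    have hev : ∀ᶠ n : ℕ in atTop, 1 / ((n : ℝ) + 1) < ε :=
      tendsto_one_div_add_atTop_nhds_zero_nat.eventually_lt_const hε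
    filter_upwards [(Nat.hyperfilter_le_atTop : (hyperfilter ℕ : Filter ℕ) ≤ atTop) hev] with n hn
    calc _ ≤ 1 - ENNReal.ofReal (1 / ((n : ℝ) + 1)) :=
          tsub_le_tsub_left (ENNReal.ofReal_le_ofReal (le_of_lt hn)) _
      _ ≤ _ := hγ0 n
      _ ≤ _ := measure_mono (Metric.ball_subset_ball (le_of_lt hn))
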